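/- Let $C([0,1])$ carry the norm $\|u\|_\infty=\sup_{t\in[0,1]}|u(t)|$, and let $k(t,s)=t$ if $0\le t\le s\le 1$, $k(t,s)=s$ if $0\le s\le t\le 1$. Consider, for $\lambda\in\mathbb{R}$, the nonlocal boundary value problem $$-u''(t)=\lambda\,\frac{\sin\left(\frac{3}{2}\pi t\right)e^{u(t)}}{\int_0^1e^{u(x)}\,dx}\quad (t\in(0,1)),\qquad u(0)=u'(1)=0,\tag{1}$$ with $u\in C^2([0,1])$ (one-sided derivatives at the endpoints), and, for $u\in C([0,1])$, the integral equation $$u(t)=\lambda\int_0^1k(t,s)\,\frac{\sin\left(\frac{3}{2}\pi s\right)e^{u(s)}}{\int_0^1e^{u(x)}\,dx}\,ds\quad (t\in[0,1]).\tag{2}$$ For $\rho>0$ and $t\in[0,1]$ set $$\underline{F_\rho}(t)=e^{-2\rho}\int_0^{2/3}k(t,s)\sin\left(\tfrac{3}{2}\pi s\right)ds+e^{2\rho}\int_{2/3}^1k(t,s)\sin\left(\tfrac{3}{2}\pi s\right)ds .$$ Then the following hold. (i) For all $\lambda\in\mathbb{R}$ and $u\in C([0,1])$, the pair $(\lambda,u)$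 solves (1) if and only if it solves (2). (ii) For every $\rho>0$, $$\underline{F_\rho}(t)=\begin{cases}e^{-2\rho}\left[\frac{4}{9\pi^2}\sin\left(\frac{3}{2}\pi t\right)+\frac{2t}{3\pi}\right]-e^{2\rho}\,\frac{2t}{3\pi},&0\le t\le\frac23,\\[1mm] e^{-2\rho}\,\frac{4}{9\pi}+e^{2\rho}\left[\frac{4}{9\pi^2}\sin\left(\frac{3}{2}\pi t\right)-\frac{4}{9\pi}\right],&\frac23\le t\le1.\end{cases}$$ (iii) If $\rho\ge\ln\sqrt[4]{2}$, then $\underline{F_\rho}\le 0=\underline{F_\rho}(0)$ on $[0,1]$. (iv) Let $0<\rho<\ln\sqrt[4]{2}$ and $t_\rho=\frac{2}{3\pi}\arccos\left(e^{4\rho}-1\right)$. Then $t_\rho\in(0,\frac23)$, $\underline{F_\rho}(t_\rho)>0$, and $t_\rho$ is the unique maximum point of $\underline{F_\rho}$ on $[0,1]$. There exist $\lambda_\rho^+>0$, $\lambda_\rho^-<0$ and $u^+,u^-\in C([0,1])$ with $\|u^+\|_\infty=\|u^-\|_\infty=\rho$ such that $(\lambda_\rho^+,u^+)$ and $(\lambda_\rho^-,u^-)$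 solve (1) and (2). Moreover, every pair $(\lambda,u)\in\mathbb{R}\times C([0,1])$ with $\|u\|_\infty=\rho$ that solves (1) or (2) satisfies $$|\lambda|\le\frac{\rho}{\underline{F_\rho}(t_\rho)} .$$ -/

import Mathlib

open Real Set

noncomputable section

/-- The extension of `u ∈ C([0,1])` to the real line by its endpoint values; on `[0,1]` it is `u`. -/
def extLine (u : C(Icc (0 : ℝ) 1, ℝ)) : ℝ → ℝ :=
  IccExtend (zero_le_one' ℝ) u

/-- The right-hand side nonlinearity `sin(3πt/2) e^{u(t)} / ∫₀¹ e^{u(x)} dx`. -/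
def nonlocalTerm (u : C(Icc (0 : ℝ) 1, ℝ)) (t : ℝ) : ℝ :=
  Real.sin (3 / 2 * π * t) * Real.exp (extLine u t) / ∫ x in (0 : ℝ)..1, Real.exp (extLine u x)

/-- The Green function of `-u''` with boundary conditions `u(0) = u'(1) = 0`. -/
def greenMixed (t s : ℝ) : ℝ :=
  if t ≤ s then t else s

/-- `(lam, u)` is a classical solution of
`-u''(t) = lam * sin(3πt/2) e^{u(t)} / ∫₀¹ e^{u(x)} dx` on `(0,1)`, `u(0) = u'(1) = 0`. -/
structure SolvesMixedBVP (lam : ℝ) (u : C(Icc (0 : ℝ) 1, ℝ)) : Prop where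
  smooth : ContDiffOn ℝ 2 (extLine u) (Icc 0 1)
  ode : ∀ t ∈ Ioo (0 : ℝ) 1, -(deriv (deriv (extLine u)) t) = lam * nonlocalTerm u t
  left_bc : extLine u 0 = 0
  right_bc : derivWithin (extLine u) (Icc 0 1) 1 = 0

/-- `(lam, u)` solves the associated Hammerstein integral equation. -/
def SolvesMixedIntegralEq (lam : ℝ) (u : C(Icc (0 : ℝ) 1, ℝ)) : Prop :=
  ∀ t ∈ Icc (0 : ℝ) 1,
    extLine u t = lam * ∫ s in (0 : ℝ)..1, greenMixed t s * nonlocalTerm u s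

/-- The lower function
`e^{-2ρ} ∫_0^{2/3} k(t,s) sin(3πs/2) ds + e^{2ρ} ∫_{2/3}^1 k(t,s) sin(3πs/2) ds`. -/
def lowerF (ρ t : ℝ) : ℝ :=
  Real.exp (-2 * ρ) * (∫ s in (0 : ℝ)..(2 / 3), greenMixed t s * Real.sin (3 / 2 * π * s))
    + Real.exp (2 * ρ) * (∫ s in (2 / 3 : ℝ)..1, greenMixed t s * Real.sin (3 / 2 * π * s))

/-- The point `t_ρ = (2/(3π)) arccos(e^{4ρ} - 1)`. -/
def maxPoint (ρ : ℝ) : ℝ :=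
  2 / (3 * π) * Real.arccos (Real.exp (4 * ρ) - 1)

end

/-!
Two observations carry the argument.

*The Green potential.* For continuous `h` the function
`greenPotential h t = ∫₀ᵗ s h(s) ds + t ∫ₜ¹ h(s) ds` is `C²` on the whole line, has derivative
`∫ₜ¹ h`, and equals `∫₀¹ k(t,s) h(s) ds` for `t ∈ [0,1]`. Together with uniqueness for `-w'' = h`,
`w(0) = w'(1) = 0` (`eq_greenPotential_of_bvp`) this identifies the boundary value problem with the
integral equation. The formulas for `lowerF` come from the same splitting of the kernel and an
explicit antiderivative; on `[0, 2/3]` they say that `lowerF` is a positive multiple of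
`sin x - (e^{4ρ} - 1) x` with `x = 3πt/2`, whose sign and maximum are elementary. The bound on the
parameter follows from `lowerF_norm_le`: the integral operator dominates `lowerF ‖u‖` pointwise.

*Existence by shooting.* The nonlocal term does not change when a constant is added to `u`. It is
therefore enough to solve the local terminal value problem `-v'' = ν sin (3πt/2) e^v`,
`v(1) = v'(1) = 0`, and to put `u = v - v(0)`, `lam = ν ∫₀¹ e^v`. With the exponential truncated to
a bounded Lipschitz function, this is a Volterra equation whose solution exists for every `ν` and
depends continuously on it (`exists_continuousOn_volterra_solution`). The norm of `u` vanishes at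
`ν = 0` and grows at least linearly in `|ν|`, because the weight has constant sign on `[2/3, 1]`
(`mul_abs_le_norm_subLeft`). By the intermediate value theorem it takes the value `ρ` for some
`ν > 0` and for some `ν < 0`; for those `ν` one has `|v| ≤ 2ρ`, so a truncation at `2ρ` is inactive.
-/

/-! ### The Green potential and the equivalence of the two problems -/

/-- The solution `t ↦ ∫₀ᵗ s h(s) ds + t ∫ₜ¹ h(s) ds` of `-p'' = h`, `p(0) = p'(1) = 0`, defined for
all real `t` so that no one-sided derivatives are needed. -/
noncomputable def greenPotential (h : ℝ → ℝ) (t : ℝ) : ℝ :=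
  (∫ s in (0 : ℝ)..t, s * h s) + t * ∫ s in t..1, h s

theorem greenPotential_zero (h : ℝ → ℝ) : greenPotential h 0 = 0 := by
  simp [greenPotential]

theorem hasDerivAt_integral_to_one {h : ℝ → ℝ} (hh : Continuous h) (t : ℝ) :
    HasDerivAt (fun x => ∫ s in x..1, h s) (-h t) t :=
  intervalIntegral.integral_hasDerivAt_left (hh.intervalIntegrable _ _)
    hh.aestronglyMeasurable.stronglyMeasurableAtFilter hh.continuousAt

theorem hasDerivAt_greenPotential {h : ℝ → ℝ} (hh : Continuous h) (t : ℝ) :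
    HasDerivAt (greenPotential h) (∫ s in t..1, h s) t := by
  have hs : Continuous fun s => s * h s := by fun_prop
  have h1 : HasDerivAt (fun x => ∫ s in (0 : ℝ)..x, s * h s) (t * h t) t :=
    intervalIntegral.integral_hasDerivAt_right (hs.intervalIntegrable _ _)
      hs.aestronglyMeasurable.stronglyMeasurableAtFilter hs.continuousAt
  have h2 := (hasDerivAt_id' t).mul (hasDerivAt_integral_to_one hh t)
  exact (h1.add h2).congr_deriv (by ring)

theorem contDiff_greenPotential {h : ℝ → ℝ} (hh : Continuous h) :
    ContDiff ℝ 2 (greenPotential h) := by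
  have h1 : deriv (greenPotential h) = fun t => ∫ s in t..1, h s :=
    funext fun t => (hasDerivAt_greenPotential hh t).deriv
  have h2 : deriv (fun t => ∫ s in t..1, h s) = fun t => -h t :=
    funext fun t => (hasDerivAt_integral_to_one hh t).deriv
  rw [show (2 : WithTop ℕ∞) = 1 + 1 by norm_num, contDiff_succ_iff_deriv]
  refine ⟨fun t => (hasDerivAt_greenPotential hh t).differentiableAt, by simp, ?_⟩
  rw [h1, contDiff_one_iff_deriv, h2]
  exact ⟨fun t => (hasDerivAt_integral_to_one hh t).differentiableAt, hh.neg⟩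

theorem greenPotential_one_sub {h : ℝ → ℝ} (hh : Continuous h) (t : ℝ) :
    greenPotential h 1 - greenPotential h t = ∫ s in t..1, (s - t) * h s := by
  have hs : Continuous fun s => s * h s := by fun_prop
  have h1 := intervalIntegral.integral_add_adjacent_intervals
    (hs.intervalIntegrable (μ := MeasureTheory.volume) 0 t) (hs.intervalIntegrable t 1)
  have h2 : ∫ s in t..1, (s - t) * h s = (∫ s in t..1, s * h s) - t * ∫ s in t..1, h s := by
    have ht : Continuous fun s => t * h s := by fun_prop
    rw [← intervalIntegral.integral_const_mul, ← intervalIntegral.integral_sub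
      (hs.intervalIntegrable _ _) (ht.intervalIntegrable _ _)]
    simp only [sub_mul]
  rw [h2]
  simp only [greenPotential, intervalIntegral.integral_same, mul_zero, add_zero]
  linarith

theorem continuous_greenMixed (t : ℝ) : Continuous (greenMixed t) := by
  have : greenMixed t = fun s => min t s := by
    ext s; simp [greenMixed, min_def]
  rw [this]
  fun_prop

theorem integral_greenMixed_mul_left (h : ℝ → ℝ) {a b t : ℝ} (hab : a ≤ b) (hb : b ≤ t) :
    ∫ s in a..b, greenMixed t s * h s = ∫ s in a..b, s * h s := by
  refine intervalIntegral.integral_congr fun s hs => ?_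
  rw [uIcc_of_le hab] at hs
  have : greenMixed t s = s := by
    unfold greenMixed; split_ifs with hts
    · linarith [hs.2]
    · rfl
  simp only [this]

theorem integral_greenMixed_mul_right (h : ℝ → ℝ) {a b t : ℝ} (hab : a ≤ b) (ht : t ≤ a) :
    ∫ s in a..b, greenMixed t s * h s = t * ∫ s in a..b, h s := by
  rw [← intervalIntegral.integral_const_mul]
  refine intervalIntegral.integral_congr fun s hs => ?_
  rw [uIcc_of_le hab] at hs
  simp only [greenMixed, if_pos (ht.trans hs.1)]

theorem integral_greenMixed_mul {h : ℝ → ℝ} (hh : Continuous h) {t : ℝ} (ht : t ∈ Icc (0 : ℝ) 1) :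
    ∫ s in (0 : ℝ)..1, greenMixed t s * h s = greenPotential h t := by
  have hc : Continuous fun s => greenMixed t s * h s := (continuous_greenMixed t).mul hh
  rw [← intervalIntegral.integral_add_adjacent_intervals (hc.intervalIntegrable 0 t)
    (hc.intervalIntegrable t 1), integral_greenMixed_mul_left h ht.1 le_rfl,
    integral_greenMixed_mul_right h ht.2 le_rfl]
  rfl

theorem constant_of_hasDerivAt_zero_Ioo {f : ℝ → ℝ} {a b : ℝ} (hf : ContinuousOn f (Icc a b))
    (hd : ∀ t ∈ Ioo a b, HasDerivAt f 0 t) {x y : ℝ} (hx : x ∈ Icc a b) (hy : y ∈ Icc a b) :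
    f x = f y := by
  have hdiff : DifferentiableOn ℝ f (interior (Icc a b)) := by
    rw [interior_Icc]
    exact fun t ht => (hd t ht).differentiableAt.differentiableWithinAt
  have hder : ∀ t ∈ interior (Icc a b), deriv f t = 0 := by
    rw [interior_Icc]
    exact fun t ht => (hd t ht).deriv
  have hm := monotoneOn_of_deriv_nonneg (convex_Icc a b) hf hdiff fun t ht => (hder t ht).ge
  have ha := antitoneOn_of_deriv_nonpos (convex_Icc a b) hf hdiff fun t ht => (hder t ht).le
  rcases le_total x y with h | h
  · exact (hm hx hy h).antisymm (ha hx hy h)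
  · exact (ha hy hx h).antisymm (hm hy hx h)

/-- A function that is `C²` on `[0,1]` and satisfies `-w'' = h`, `w(0) = w'(1) = 0` is the Green
potential of `h`. -/
theorem eq_greenPotential_of_bvp {w h : ℝ → ℝ} (hh : Continuous h)
    (hw : ContDiffOn ℝ 2 w (Icc 0 1)) (hode : ∀ t ∈ Ioo (0 : ℝ) 1, -(deriv (deriv w) t) = h t)
    (h0 : w 0 = 0) (h1 : derivWithin w (Icc 0 1) 1 = 0) :
    ∀ t ∈ Icc (0 : ℝ) 1, w t = greenPotential h t := by
  have hU : UniqueDiffOn ℝ (Icc (0 : ℝ) 1) := uniqueDiffOn_Icc one_pos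
  have hd : ContDiffOn ℝ 1 (derivWithin w (Icc 0 1)) (Icc 0 1) :=
    hw.derivWithin hU (by norm_num)
  have hdw : ∀ t ∈ Ioo (0 : ℝ) 1, derivWithin w (Icc 0 1) t = deriv w t := fun t ht =>
    derivWithin_of_mem_nhds (Icc_mem_nhds ht.1 ht.2)
  have hddw : ∀ t ∈ Ioo (0 : ℝ) 1, HasDerivAt (derivWithin w (Icc 0 1)) (-h t) t := by
    intro t ht
    have hda : DifferentiableAt ℝ (derivWithin w (Icc 0 1)) t :=
      (hd.differentiableOn (by norm_num) t (Ioo_subset_Icc_self ht)).differentiableAt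
        (Icc_mem_nhds ht.1 ht.2)
    have he : derivWithin w (Icc 0 1) =ᶠ[nhds t] deriv w :=
      Filter.eventuallyEq_of_mem (Ioo_mem_nhds ht.1 ht.2) hdw
    have := hda.hasDerivAt
    rwa [he.deriv_eq, ← neg_neg (deriv (deriv w) t), hode t ht] at this
  have hcint : Continuous fun x => ∫ s in x..1, h s :=
    continuous_iff_continuousAt.2 fun x => (hasDerivAt_integral_to_one hh x).continuousAt
  have hcP : Continuous (greenPotential h) :=
    continuous_iff_continuousAt.2 fun x => (hasDerivAt_greenPotential hh x).continuousAt
  have hfirst : ∀ t ∈ Icc (0 : ℝ) 1, derivWithin w (Icc 0 1) t = ∫ s in t..1, h s := by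
    intro t ht
    have hconst := constant_of_hasDerivAt_zero_Ioo (hd.continuousOn.sub hcint.continuousOn)
      (fun x hx => ((hddw x hx).sub (hasDerivAt_integral_to_one hh x)).congr_deriv (by ring))
      ht (right_mem_Icc.2 zero_le_one)
    simp only [Pi.sub_apply, h1, intervalIntegral.integral_same, sub_zero] at hconst
    exact sub_eq_zero.1 hconst
  have hw' : ∀ t ∈ Ioo (0 : ℝ) 1, HasDerivAt w (∫ s in t..1, h s) t := by
    intro t ht
    have hda : DifferentiableAt ℝ w t :=
      (hw.differentiableOn (by norm_num) t (Ioo_subset_Icc_self ht)).differentiableAt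
        (Icc_mem_nhds ht.1 ht.2)
    rw [← hfirst t (Ioo_subset_Icc_self ht), hdw t ht]
    exact hda.hasDerivAt
  intro t ht
  have hconst := constant_of_hasDerivAt_zero_Ioo (hw.continuousOn.sub hcP.continuousOn)
    (fun x hx => ((hw' x hx).sub (hasDerivAt_greenPotential hh x)).congr_deriv (by ring))
    ht (left_mem_Icc.2 zero_le_one)
  simp only [Pi.sub_apply, h0, greenPotential_zero, sub_zero] at hconst
  exact sub_eq_zero.1 hconst

theorem continuous_extLine (u : C(Icc (0 : ℝ) 1, ℝ)) : Continuous (extLine u) :=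
  u.continuous.Icc_extend'

theorem continuous_nonlocalTerm (u : C(Icc (0 : ℝ) 1, ℝ)) : Continuous (nonlocalTerm u) := by
  have := continuous_extLine u
  unfold nonlocalTerm
  fun_prop

theorem solvesMixedIntegralEq_iff (lam : ℝ) (u : C(Icc (0 : ℝ) 1, ℝ)) :
    SolvesMixedIntegralEq lam u ↔
      ∀ t ∈ Icc (0 : ℝ) 1, extLine u t = lam * greenPotential (nonlocalTerm u) t :=
  forall₂_congr fun t ht => by rw [integral_greenMixed_mul (continuous_nonlocalTerm u) ht]

theorem greenPotential_const_mul (c : ℝ) (h : ℝ → ℝ) (t : ℝ) :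
    greenPotential (fun s => c * h s) t = c * greenPotential h t := by
  simp only [greenPotential, mul_left_comm _ c, intervalIntegral.integral_const_mul, mul_add]

theorem solvesMixedBVP_iff_solvesMixedIntegralEq (lam : ℝ) (u : C(Icc (0 : ℝ) 1, ℝ)) :
    SolvesMixedBVP lam u ↔ SolvesMixedIntegralEq lam u := by
  have hc := continuous_nonlocalTerm u
  have hh : Continuous fun t => lam * nonlocalTerm u t := continuous_const.mul hc
  simp only [solvesMixedIntegralEq_iff, ← greenPotential_const_mul]
  constructor
  · intro H
    exact eq_greenPotential_of_bvp hh H.smooth H.ode H.left_bc H.right_bc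
  · intro H
    have hd : deriv (greenPotential fun t => lam * nonlocalTerm u t)
        = fun t => ∫ s in t..1, lam * nonlocalTerm u s :=
      funext fun t => (hasDerivAt_greenPotential hh t).deriv
    refine ⟨(contDiff_greenPotential hh).contDiffOn.congr H, fun t ht => ?_, ?_, ?_⟩
    · have he : extLine u =ᶠ[nhds t] greenPotential fun t => lam * nonlocalTerm u t :=
        Filter.eventuallyEq_of_mem (Icc_mem_nhds ht.1 ht.2) H
      rw [he.deriv.deriv_eq, hd, (hasDerivAt_integral_to_one hh t).deriv, neg_neg]
    · rw [H 0 (by simp), greenPotential_zero]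
    · rw [derivWithin_congr H (H 1 (by simp)),
        ((hasDerivAt_greenPotential hh 1).hasDerivWithinAt.derivWithin
          (uniqueDiffOn_Icc one_pos 1 (by simp))), intervalIntegral.integral_same]

/-! ### The lower function -/

theorem hasDerivAt_sin_sub_mul_cos (x : ℝ) :
    HasDerivAt (fun s => 4 / (9 * π ^ 2) * Real.sin (3 / 2 * π * s)
      - 2 / (3 * π) * (s * Real.cos (3 / 2 * π * s))) (x * Real.sin (3 / 2 * π * x)) x := by
  have hl : HasDerivAt (fun s : ℝ => 3 / 2 * π * s) (3 / 2 * π) x := by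
    simpa using (hasDerivAt_id' x).const_mul (3 / 2 * π)
  have h := (hl.sin.const_mul (4 / (9 * π ^ 2))).sub
    (((hasDerivAt_id' x).mul hl.cos).const_mul (2 / (3 * π)))
  have := Real.pi_pos.ne'
  refine h.congr_deriv ?_
  field_simp
  ring

theorem integral_mul_sin (a b : ℝ) :
    ∫ s in a..b, s * Real.sin (3 / 2 * π * s) =
      (4 / (9 * π ^ 2) * Real.sin (3 / 2 * π * b) - 2 / (3 * π) * (b * Real.cos (3 / 2 * π * b)))
      - (4 / (9 * π ^ 2) * Real.sin (3 / 2 * π * a)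
        - 2 / (3 * π) * (a * Real.cos (3 / 2 * π * a))) :=
  intervalIntegral.integral_eq_sub_of_hasDerivAt (fun x _ => hasDerivAt_sin_sub_mul_cos x)
    (Continuous.intervalIntegrable (by fun_prop) _ _)

theorem integral_sin_mul (a b : ℝ) :
    ∫ s in a..b, Real.sin (3 / 2 * π * s) =
      2 / (3 * π) * (Real.cos (3 / 2 * π * a) - Real.cos (3 / 2 * π * b)) := by
  have := Real.pi_pos.ne'
  rw [intervalIntegral.integral_comp_mul_left (fun x => Real.sin x) (by positivity), integral_sin]
  simp only [smul_eq_mul]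
  field_simp

theorem cos_mul_two_thirds : Real.cos (3 / 2 * π * (2 / 3)) = -1 := by
  rw [show 3 / 2 * π * (2 / 3) = π by ring, Real.cos_pi]

theorem sin_mul_two_thirds : Real.sin (3 / 2 * π * (2 / 3)) = 0 := by
  rw [show 3 / 2 * π * (2 / 3) = π by ring, Real.sin_pi]

theorem cos_mul_one : Real.cos (3 / 2 * π * 1) = 0 := by
  rw [show 3 / 2 * π * 1 = π / 2 + π by ring, Real.cos_add_pi, Real.cos_pi_div_two, neg_zero]

theorem lowerF_of_le {ρ t : ℝ} (ht : t ∈ Icc (0 : ℝ) (2 / 3)) :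
    lowerF ρ t =
      Real.exp (-2 * ρ) * (4 / (9 * π ^ 2) * Real.sin (3 / 2 * π * t) + 2 * t / (3 * π))
        + Real.exp (2 * ρ) * (-(2 * t / (3 * π))) := by
  have hc : Continuous fun s => greenMixed t s * Real.sin (3 / 2 * π * s) :=
    (continuous_greenMixed t).mul (by fun_prop)
  have hπ := Real.pi_pos.ne'
  rw [lowerF, integral_greenMixed_mul_right _ (by norm_num) ht.2,
    ← intervalIntegral.integral_add_adjacent_intervals (hc.intervalIntegrable 0 t)
      (hc.intervalIntegrable t (2 / 3)), integral_greenMixed_mul_left _ ht.1 le_rfl,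
    integral_greenMixed_mul_right _ ht.2 le_rfl]
  simp only [integral_mul_sin, integral_sin_mul, cos_mul_two_thirds, cos_mul_one, mul_zero,
    Real.sin_zero]
  ring

theorem lowerF_of_ge {ρ t : ℝ} (ht : t ∈ Icc (2 / 3 : ℝ) 1) :
    lowerF ρ t =
      Real.exp (-2 * ρ) * (4 / (9 * π))
        + Real.exp (2 * ρ) *
          (4 / (9 * π ^ 2) * Real.sin (3 / 2 * π * t) - 4 / (9 * π)) := by
  have hc : Continuous fun s => greenMixed t s * Real.sin (3 / 2 * π * s) :=
    (continuous_greenMixed t).mul (by fun_prop)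
  have hπ := Real.pi_pos.ne'
  rw [lowerF, integral_greenMixed_mul_left _ (by norm_num) ht.1,
    ← intervalIntegral.integral_add_adjacent_intervals (hc.intervalIntegrable (2 / 3) t)
      (hc.intervalIntegrable t 1), integral_greenMixed_mul_left _ ht.1 le_rfl,
    integral_greenMixed_mul_right _ ht.2 le_rfl]
  simp only [integral_mul_sin, integral_sin_mul, cos_mul_two_thirds, sin_mul_two_thirds,
    cos_mul_one, mul_zero, Real.sin_zero]
  field_simp
  ring

/-- On `[0, 2/3]` the lower function is, up to a positive factor, `sin x - (e^{4ρ} - 1) x` with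
`x = 3πt/2`. -/
theorem lowerF_eq_sin_sub {ρ t : ℝ} (ht : t ∈ Icc (0 : ℝ) (2 / 3)) :
    lowerF ρ t = Real.exp (-2 * ρ) * (4 / (9 * π ^ 2)) *
      (Real.sin (3 / 2 * π * t) - (Real.exp (4 * ρ) - 1) * (3 / 2 * π * t)) := by
  have hE : Real.exp (2 * ρ) = Real.exp (-2 * ρ) * Real.exp (4 * ρ) := by
    rw [← Real.exp_add]; ring_nf
  have hπ := Real.pi_pos.ne'
  rw [lowerF_of_le ht, hE]
  field_simp
  ring

theorem sin_nonneg_of_le_two_thirds {t : ℝ} (ht : t ∈ Icc (0 : ℝ) (2 / 3)) :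
    0 ≤ Real.sin (3 / 2 * π * t) :=
  Real.sin_nonneg_of_nonneg_of_le_pi (mul_nonneg (by positivity) ht.1)
    (by nlinarith [Real.pi_pos, ht.2])

theorem sin_neg_of_two_thirds_lt {t : ℝ} (ht : t ∈ Ioc (2 / 3 : ℝ) 1) :
    Real.sin (3 / 2 * π * t) < 0 := by
  rw [← neg_pos, ← Real.sin_sub_pi]
  exact Real.sin_pos_of_pos_of_lt_pi (by nlinarith [Real.pi_pos, ht.1])
    (by nlinarith [Real.pi_pos, ht.2])

theorem sin_nonpos_of_two_thirds_le {t : ℝ} (ht : t ∈ Icc (2 / 3 : ℝ) 1) :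
    Real.sin (3 / 2 * π * t) ≤ 0 := by
  rcases ht.1.eq_or_lt with h | h
  · rw [← h, sin_mul_two_thirds]
  · exact (sin_neg_of_two_thirds_lt ⟨h, ht.2⟩).le

theorem lowerF_neg_of_ge {ρ t : ℝ} (hρ : 0 < ρ) (ht : t ∈ Icc (2 / 3 : ℝ) 1) :
    lowerF ρ t < 0 := by
  have hs := sin_nonpos_of_two_thirds_le ht
  have hlt : Real.exp (-2 * ρ) < Real.exp (2 * ρ) := Real.exp_lt_exp.2 (by linarith)
  have hk : 0 < 4 / (9 * π) := by positivity
  have hk2 : 0 < 4 / (9 * π ^ 2) := by positivity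
  rw [lowerF_of_ge ht]
  have h1 := mul_lt_mul_of_pos_right hlt hk
  have h2 : Real.exp (2 * ρ) * (4 / (9 * π ^ 2) * Real.sin (3 / 2 * π * t)) ≤ 0 :=
    mul_nonpos_of_nonneg_of_nonpos (Real.exp_pos _).le
      (mul_nonpos_of_nonneg_of_nonpos hk2.le hs)
  linarith

theorem log_two_rpow_quarter : Real.log ((2 : ℝ) ^ (1 / 4 : ℝ)) = Real.log 2 / 4 := by
  rw [Real.log_rpow two_pos]; ring

theorem lowerF_zero (ρ : ℝ) : lowerF ρ 0 = 0 := by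
  rw [lowerF_eq_sin_sub (by constructor <;> norm_num)]
  simp

theorem lowerF_nonpos {ρ t : ℝ} (hρ : Real.log ((2 : ℝ) ^ (1 / 4 : ℝ)) ≤ ρ)
    (ht : t ∈ Icc (0 : ℝ) 1) : lowerF ρ t ≤ 0 := by
  rw [log_two_rpow_quarter] at hρ
  have hl := Real.log_pos one_lt_two
  rcases le_total t (2 / 3) with h | h
  · have hE : 2 ≤ Real.exp (4 * ρ) := by
      rw [← Real.log_le_iff_le_exp two_pos]; linarith
    have hx : 0 ≤ 3 / 2 * π * t := mul_nonneg (by positivity) ht.1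
    rw [lowerF_eq_sin_sub ⟨ht.1, h⟩]
    refine mul_nonpos_of_nonneg_of_nonpos (by positivity) ?_
    nlinarith [Real.sin_le hx]
  · exact (lowerF_neg_of_ge (by linarith) ⟨h, ht.2⟩).le

/-- For `0 < c < 1` the function `sin x - c x` has its strict maximum over `[0, π]` at `arccos c`:
its derivative `cos x - c` is positive before and negative after that point. -/
theorem sin_sub_mul_lt_of_ne_arccos {c x : ℝ} (hc0 : 0 < c) (hc1 : c < 1) (hx : x ∈ Icc 0 π)
    (hne : x ≠ Real.arccos c) :
    Real.sin x - c * x < Real.sin (Real.arccos c) - c * Real.arccos c := by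
  have hcos : Real.cos (Real.arccos c) = c := Real.cos_arccos (by linarith) hc1.le
  have hder : ∀ y, deriv (fun x => Real.sin x - c * x) y = Real.cos y - c := fun y =>
    (((Real.hasDerivAt_sin y).sub ((hasDerivAt_id' y).const_mul c)).congr_deriv
      (by rw [mul_one])).deriv
  have hcont : Continuous fun x => Real.sin x - c * x := by fun_prop
  rcases hne.lt_or_gt with h | h
  · refine strictMonoOn_of_deriv_pos (convex_Icc 0 (Real.arccos c)) hcont.continuousOn ?_
      ⟨hx.1, h.le⟩ ⟨Real.arccos_nonneg c, le_rfl⟩ h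
    intro y hy
    rw [interior_Icc] at hy
    have := Real.cos_lt_cos_of_nonneg_of_le_pi hy.1.le (Real.arccos_le_pi c) hy.2
    rw [hder]; linarith
  · refine strictAntiOn_of_deriv_neg (convex_Icc (Real.arccos c) π) hcont.continuousOn ?_
      ⟨le_rfl, Real.arccos_le_pi c⟩ ⟨h.le, hx.2⟩ h
    intro y hy
    rw [interior_Icc] at hy
    have := Real.cos_lt_cos_of_nonneg_of_le_pi (Real.arccos_nonneg c) hy.2.le hy.1
    rw [hder]; linarith

theorem mul_maxPoint (ρ : ℝ) : 3 / 2 * π * maxPoint ρ = Real.arccos (Real.exp (4 * ρ) - 1) := by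
  have := Real.pi_pos.ne'
  rw [maxPoint]
  field_simp

theorem maxPoint_isStrictMax {ρ : ℝ} (h0 : 0 < ρ) (h1 : ρ < Real.log ((2 : ℝ) ^ (1 / 4 : ℝ))) :
    maxPoint ρ ∈ Ioo (0 : ℝ) (2 / 3) ∧ 0 < lowerF ρ (maxPoint ρ) ∧
      ∀ t ∈ Icc (0 : ℝ) 1, t ≠ maxPoint ρ → lowerF ρ t < lowerF ρ (maxPoint ρ) := by
  rw [log_two_rpow_quarter] at h1
  have hπ := Real.pi_pos
  have hc0 : 0 < Real.exp (4 * ρ) - 1 := by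
    have := Real.add_one_lt_exp (x := 4 * ρ) (by positivity); linarith
  have hc1 : Real.exp (4 * ρ) - 1 < 1 := by
    have : Real.exp (4 * ρ) < 2 := by
      rw [← Real.lt_log_iff_exp_lt two_pos]; linarith
    linarith
  have hm := mul_maxPoint ρ
  have ha0 : 0 < Real.arccos (Real.exp (4 * ρ) - 1) := Real.arccos_pos.2 hc1
  have ha1 : Real.arccos (Real.exp (4 * ρ) - 1) < π / 2 := Real.arccos_lt_pi_div_two.2 hc0
  have hmem : maxPoint ρ ∈ Ioo (0 : ℝ) (2 / 3) := by
    constructor <;> nlinarith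
  have hk : 0 < Real.exp (-2 * ρ) * (4 / (9 * π ^ 2)) := by positivity
  have hlt : ∀ t ∈ Icc (0 : ℝ) (2 / 3), t ≠ maxPoint ρ →
      lowerF ρ t < lowerF ρ (maxPoint ρ) := by
    intro t ht hne
    rw [lowerF_eq_sin_sub ht, lowerF_eq_sin_sub (Ioo_subset_Icc_self hmem), hm]
    refine mul_lt_mul_of_pos_left (sin_sub_mul_lt_of_ne_arccos hc0 hc1
      ⟨mul_nonneg (by positivity) ht.1, by nlinarith [ht.2]⟩ fun h => hne ?_) hk
    exact mul_left_cancel₀ (by positivity : 3 / 2 * π ≠ 0) (h.trans hm.symm)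
  have hpos : 0 < lowerF ρ (maxPoint ρ) := by
    rw [← lowerF_zero ρ]
    exact hlt 0 (by constructor <;> norm_num) hmem.1.ne
  refine ⟨hmem, hpos, fun t ht hne => ?_⟩
  rcases le_total t (2 / 3) with h | h
  · exact hlt t ⟨ht.1, h⟩ hne
  · exact (lowerF_neg_of_ge h0 ⟨h, ht.2⟩).trans hpos

/-! ### The a priori bound on the parameter -/

theorem extLine_apply (u : C(Icc (0 : ℝ) 1, ℝ)) {t : ℝ} (ht : t ∈ Icc (0 : ℝ) 1) :
    extLine u t = u ⟨t, ht⟩ :=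
  IccExtend_of_mem _ _ ht

theorem abs_extLine_le (u : C(Icc (0 : ℝ) 1, ℝ)) (t : ℝ) : |extLine u t| ≤ ‖u‖ :=
  u.norm_coe_le_norm _

theorem exp_neg_norm_le_integral (u : C(Icc (0 : ℝ) 1, ℝ)) :
    Real.exp (-‖u‖) ≤ ∫ x in (0 : ℝ)..1, Real.exp (extLine u x) := by
  have hc : Continuous fun x => Real.exp (extLine u x) := (continuous_extLine u).rexp
  have h := intervalIntegral.integral_mono_on (μ := MeasureTheory.volume) (zero_le_one' ℝ)
    ((continuous_const (y := Real.exp (-‖u‖))).intervalIntegrable 0 1) (hc.intervalIntegrable 0 1)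
    fun x _ => Real.exp_le_exp.2 (neg_le_of_abs_le (abs_extLine_le u x))
  simpa using h

theorem integral_le_exp_norm (u : C(Icc (0 : ℝ) 1, ℝ)) :
    (∫ x in (0 : ℝ)..1, Real.exp (extLine u x)) ≤ Real.exp ‖u‖ := by
  have hc : Continuous fun x => Real.exp (extLine u x) := (continuous_extLine u).rexp
  have h := intervalIntegral.integral_mono_on (μ := MeasureTheory.volume) (zero_le_one' ℝ)
    (hc.intervalIntegrable 0 1)
    ((continuous_const (y := Real.exp ‖u‖)).intervalIntegrable 0 1)
    fun x _ => Real.exp_le_exp.2 (le_of_abs_le (abs_extLine_le u x))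
  simpa using h

theorem integral_exp_pos (u : C(Icc (0 : ℝ) 1, ℝ)) :
    0 < ∫ x in (0 : ℝ)..1, Real.exp (extLine u x) :=
  (Real.exp_pos _).trans_le (exp_neg_norm_le_integral u)

/-- The normalised exponential `e^u / ∫₀¹ e^u` lies between `e^{-2‖u‖}` and `e^{2‖u‖}`, and the
weight `sin (3πs/2)` is nonnegative on `[0, 2/3]` and nonpositive on `[2/3, 1]`. -/
theorem lowerF_norm_le (u : C(Icc (0 : ℝ) 1, ℝ)) {t : ℝ} (ht : t ∈ Icc (0 : ℝ) 1) :
    lowerF ‖u‖ t ≤ ∫ s in (0 : ℝ)..1, greenMixed t s * nonlocalTerm u s := by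
  have hI := integral_exp_pos u
  have hlo : ∀ s, Real.exp (-2 * ‖u‖) ≤
      Real.exp (extLine u s) / ∫ x in (0 : ℝ)..1, Real.exp (extLine u x) := by
    intro s
    rw [le_div_iff₀ hI]
    calc _ ≤ Real.exp (-2 * ‖u‖) * Real.exp ‖u‖ := by gcongr; exact integral_le_exp_norm u
      _ = Real.exp (-‖u‖) := by rw [← Real.exp_add]; ring_nf
      _ ≤ _ := Real.exp_le_exp.2 (neg_le_of_abs_le (abs_extLine_le u s))
  have hhi : ∀ s, Real.exp (extLine u s) / (∫ x in (0 : ℝ)..1, Real.exp (extLine u x))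
      ≤ Real.exp (2 * ‖u‖) := by
    intro s
    rw [div_le_iff₀ hI]
    calc _ ≤ Real.exp ‖u‖ := Real.exp_le_exp.2 (le_of_abs_le (abs_extLine_le u s))
      _ = Real.exp (2 * ‖u‖) * Real.exp (-‖u‖) := by rw [← Real.exp_add]; ring_nf
      _ ≤ _ := by gcongr; exact exp_neg_norm_le_integral u
  have hk : ∀ s, 0 ≤ s → 0 ≤ greenMixed t s := by
    intro s hs
    unfold greenMixed
    split_ifs
    exacts [ht.1, hs]
  have hg := continuous_greenMixed t
  have hn := continuous_nonlocalTerm u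
  have hc : Continuous fun s => greenMixed t s * nonlocalTerm u s := hg.mul hn
  have hcs : ∀ c : ℝ, Continuous fun s => c * (greenMixed t s * Real.sin (3 / 2 * π * s)) :=
    fun c => by fun_prop
  rw [lowerF, ← intervalIntegral.integral_const_mul, ← intervalIntegral.integral_const_mul,
    ← intervalIntegral.integral_add_adjacent_intervals (hc.intervalIntegrable 0 (2 / 3))
      (hc.intervalIntegrable (2 / 3) 1)]
  refine add_le_add
    (intervalIntegral.integral_mono_on (by norm_num) ((hcs _).intervalIntegrable _ _)
      (hc.intervalIntegrable _ _) fun s hs => ?_)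
    (intervalIntegral.integral_mono_on (by norm_num) ((hcs _).intervalIntegrable _ _)
      (hc.intervalIntegrable _ _) fun s hs => ?_)
  · rw [nonlocalTerm, mul_div_assoc, ← mul_assoc (greenMixed t s), mul_comm (Real.exp _)]
    exact mul_le_mul_of_nonneg_left (hlo s)
      (mul_nonneg (hk s hs.1) (sin_nonneg_of_le_two_thirds hs))
  · rw [nonlocalTerm, mul_div_assoc, ← mul_assoc (greenMixed t s), mul_comm (Real.exp _)]
    exact mul_le_mul_of_nonpos_left (hhi s)
      (mul_nonpos_of_nonneg_of_nonpos (hk s (by linarith [hs.1])) (sin_nonpos_of_two_thirds_le hs))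

theorem abs_le_div_lowerF {lam : ℝ} {u : C(Icc (0 : ℝ) 1, ℝ)} (h : SolvesMixedIntegralEq lam u)
    {t : ℝ} (ht : t ∈ Icc (0 : ℝ) 1) (hpos : 0 < lowerF ‖u‖ t) :
    |lam| ≤ ‖u‖ / lowerF ‖u‖ t := by
  have hK := lowerF_norm_le u ht
  rw [le_div_iff₀ hpos]
  calc |lam| * lowerF ‖u‖ t
      ≤ |lam| * |∫ s in (0 : ℝ)..1, greenMixed t s * nonlocalTerm u s| := by
        gcongr
        exact hK.trans (le_abs_self _)
    _ = |extLine u t| := by rw [h t ht, abs_mul]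
    _ ≤ ‖u‖ := abs_extLine_le u t

/-! ### A Volterra equation depending on a parameter -/

theorem continuous_greenPotential {h : ℝ → ℝ} (hh : Continuous h) :
    Continuous (greenPotential h) :=
  (contDiff_greenPotential hh).continuous

/-- The terminal value problem `-v'' = g(t) φ(v)`, `v(1) = v'(1) = 0` as a fixed-point problem: the
operator `v ↦ p - p(1)`, where `p` is the Green potential of `g φ(v)`. -/
noncomputable def volterra (g φ : C(ℝ, ℝ)) (v : C(Icc (0 : ℝ) 1, ℝ)) : C(Icc (0 : ℝ) 1, ℝ) where
  toFun t := greenPotential (fun s => g s * φ (extLine v s)) t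
    - greenPotential (fun s => g s * φ (extLine v s)) 1
  continuous_toFun := by
    have := continuous_extLine v
    have := continuous_greenPotential (h := fun s => g s * φ (extLine v s)) (by fun_prop)
    fun_prop

theorem volterra_apply (g φ : C(ℝ, ℝ)) (v : C(Icc (0 : ℝ) 1, ℝ)) (t : Icc (0 : ℝ) 1) :
    volterra g φ v t = -∫ s in (t : ℝ)..1, (s - t) * (g s * φ (extLine v s)) := by
  have := continuous_extLine v
  rw [← greenPotential_one_sub (by fun_prop), neg_sub]
  rfl

theorem norm_volterra_le {g φ : C(ℝ, ℝ)} {M : ℝ} (hg : ∀ t, |g t| ≤ 1) (hM : ∀ x, |φ x| ≤ M)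
    (v : C(Icc (0 : ℝ) 1, ℝ)) : ‖volterra g φ v‖ ≤ M := by
  have hM0 : 0 ≤ M := (abs_nonneg _).trans (hM 0)
  refine (ContinuousMap.norm_le _ hM0).2 fun t => ?_
  rw [volterra_apply, norm_neg]
  refine (intervalIntegral.norm_integral_le_of_norm_le_const (C := M) fun s hs => ?_).trans ?_
  · rw [uIoc_of_le t.2.2] at hs
    have h1 : |s - t| ≤ 1 := by
      rw [abs_le]; constructor <;> linarith [hs.1, hs.2, t.2.1]
    rw [Real.norm_eq_abs, abs_mul, abs_mul]
    calc |s - t| * (|g s| * |φ (extLine v s)|) ≤ 1 * (1 * M) := by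
          gcongr
          exacts [hg s, hM _]
      _ = M := by ring
  · rw [abs_of_nonneg (by linarith [t.2.2])]
    nlinarith [t.2.1]

theorem integral_exp_mul_one_sub_le {β : ℝ} (hβ : 0 < β) (t : ℝ) :
    ∫ s in t..1, Real.exp (β * (1 - s)) ≤ Real.exp (β * (1 - t)) / β := by
  have hd : ∀ x ∈ uIcc t 1, HasDerivAt (fun s => -(Real.exp (β * (1 - s)) / β))
      (Real.exp (β * (1 - x))) x := by
    intro x _
    have h := ((((hasDerivAt_id' x).const_sub 1).const_mul β).exp.div_const β).fun_neg
    refine h.congr_deriv ?_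
    field_simp
  rw [intervalIntegral.integral_eq_sub_of_hasDerivAt hd
    (Continuous.intervalIntegrable (by fun_prop) _ _)]
  have : 0 < Real.exp (β * (1 - 1)) / β := by positivity
  linarith

/-- In the norm weighted by `e^{-β(1-t)}` the Volterra operator has Lipschitz constant `L/β`. -/
theorem abs_volterra_sub_le {g φ : C(ℝ, ℝ)} {L β D : ℝ} (hg : ∀ t, |g t| ≤ 1)
    (hL0 : 0 ≤ L) (hL : ∀ x y, |φ x - φ y| ≤ L * |x - y|) (hβ : 0 < β) (hD : 0 ≤ D)
    {v w : C(Icc (0 : ℝ) 1, ℝ)}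
    (hvw : ∀ s : Icc (0 : ℝ) 1, |v s - w s| ≤ D * Real.exp (β * (1 - s)))
    (t : Icc (0 : ℝ) 1) :
    |volterra g φ v t - volterra g φ w t| ≤ L * D * (Real.exp (β * (1 - t)) / β) := by
  have hv := continuous_extLine v
  have hw := continuous_extLine w
  have hcv : Continuous fun s : ℝ => (s - t) * (g s * φ (extLine v s)) := by fun_prop
  have hcw : Continuous fun s : ℝ => (s - t) * (g s * φ (extLine w s)) := by fun_prop
  rw [volterra_apply, volterra_apply, neg_sub_neg, ← intervalIntegral.integral_sub
    (hcw.intervalIntegrable _ _) (hcv.intervalIntegrable _ _), ← Real.norm_eq_abs]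
  have hce : Continuous fun s : ℝ => L * D * Real.exp (β * (1 - s)) := by fun_prop
  refine (intervalIntegral.norm_integral_le_of_norm_le t.2.2
    (Filter.Eventually.of_forall fun s hs => ?_) (hce.intervalIntegrable _ _)).trans ?_
  · have hs' : s ∈ Icc (0 : ℝ) 1 := ⟨t.2.1.trans hs.1.le, hs.2⟩
    have h1 : |s - t| ≤ 1 := by
      rw [abs_le]; constructor <;> linarith [hs.1, hs.2, t.2.1]
    have h2 : |extLine w s - extLine v s| ≤ D * Real.exp (β * (1 - s)) := by
      rw [abs_sub_comm, extLine_apply v hs', extLine_apply w hs']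
      exact hvw ⟨s, hs'⟩
    rw [Real.norm_eq_abs, ← mul_sub, ← mul_sub, abs_mul, abs_mul]
    calc |s - t| * (|g s| * |φ (extLine w s) - φ (extLine v s)|)
        ≤ 1 * (1 * (L * (D * Real.exp (β * (1 - s))))) := by
          gcongr
          · exact hg s
          · exact (hL _ _).trans (by gcongr)
      _ = L * D * Real.exp (β * (1 - s)) := by ring
  · rw [intervalIntegral.integral_const_mul]
    have := integral_exp_mul_one_sub_le hβ t
    gcongr

/-- For bounded Lipschitz `φ` the equation `v = ν · volterra g φ v` has, for `ν` in a bounded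
interval, a solution depending continuously on `ν`. In the weighted norm the right-hand side is a
`1/2`-contraction once the weight exponent is large, uniformly in `ν`, and the fixed point of a
uniform family of contractions is Lipschitz in the parameter. -/
theorem exists_continuousOn_volterra_solution {g φ : C(ℝ, ℝ)} {L M N : ℝ} (hg : ∀ t, |g t| ≤ 1)
    (hL0 : 0 ≤ L) (hL : ∀ x y, |φ x - φ y| ≤ L * |x - y|) (hM : ∀ x, |φ x| ≤ M) (hN : 0 ≤ N) :
    ∃ V : ℝ → C(Icc (0 : ℝ) 1, ℝ), ContinuousOn V (Icc (-N) N) ∧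
      ∀ ν ∈ Icc (-N) N, V ν = ν • volterra g φ (V ν) := by
  -- the weight exponent is chosen so that `Φ ν` below is a `1/2`-contraction for all `|ν| ≤ N`
  obtain ⟨β, hβ, hβL⟩ : ∃ β : ℝ, 0 < β ∧ N * L / β ≤ 1 / 2 := by
    have h : 0 ≤ N * L := mul_nonneg hN hL0
    refine ⟨2 * (N * L) + 1, by positivity, ?_⟩
    rw [div_le_iff₀ (by positivity)]
    linarith
  let E : C(Icc (0 : ℝ) 1, ℝ) := ⟨fun t => Real.exp (β * (1 - t)), by fun_prop⟩
  let E' : C(Icc (0 : ℝ) 1, ℝ) := ⟨fun t => Real.exp (-(β * (1 - t))), by fun_prop⟩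
  have hEE' : E * E' = 1 := by
    ext t
    change Real.exp (β * (1 - t)) * Real.exp (-(β * (1 - t))) = 1
    rw [← Real.exp_add, add_neg_cancel, Real.exp_zero]
  have hE' : ‖E'‖ ≤ 1 := by
    refine (ContinuousMap.norm_le _ zero_le_one).2 fun t => ?_
    change ‖Real.exp (-(β * (1 - t)))‖ ≤ 1
    rw [Real.norm_eq_abs, Real.abs_exp, Real.exp_le_one_iff]
    nlinarith [t.2.2]
  -- the operator conjugated by the weight, so that the sup norm of `w` is the weighted norm of
  -- `v = E * w`
  let Φ : ℝ → C(Icc (0 : ℝ) 1, ℝ) → C(Icc (0 : ℝ) 1, ℝ) :=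
    fun ν w => ν • (E' * volterra g φ (E * w))
  have hΦ : ∀ ν ∈ Icc (-N) N, ∀ w w', ‖Φ ν w - Φ ν w'‖ ≤ 1 / 2 * ‖w - w'‖ := by
    intro ν hν w w'
    refine (ContinuousMap.norm_le _ (by positivity)).2 fun t => ?_
    have hb := abs_volterra_sub_le hg hL0 hL hβ (norm_nonneg (w - w'))
      (v := E * w) (w := E * w') (fun s => by
        change |Real.exp (β * (1 - s)) * w s - Real.exp (β * (1 - s)) * w' s| ≤ _
        rw [← mul_sub, abs_mul, Real.abs_exp, mul_comm]
        gcongr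
        exact (w - w').norm_coe_le_norm s) t
    have habs : |ν| ≤ N := abs_le.2 hν
    change ‖ν * (Real.exp (-(β * (1 - t))) * volterra g φ (E * w) t)
      - ν * (Real.exp (-(β * (1 - t))) * volterra g φ (E * w') t)‖ ≤ _
    rw [← mul_sub, ← mul_sub, Real.norm_eq_abs, abs_mul, abs_mul, Real.abs_exp]
    calc _ ≤ N * (Real.exp (-(β * (1 - t)))
            * (L * ‖w - w'‖ * (Real.exp (β * (1 - t)) / β))) := by gcongr
      _ = N * L / β * ‖w - w'‖ * (Real.exp (β * (1 - t)) * Real.exp (-(β * (1 - t)))) := by ring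
      _ = N * L / β * ‖w - w'‖ := by
        rw [← Real.exp_add, add_neg_cancel, Real.exp_zero, mul_one]
      _ ≤ 1 / 2 * ‖w - w'‖ := by gcongr
  have hfix : ∀ ν, ∃ w, ν ∈ Icc (-N) N → Φ ν w = w := by
    intro ν
    by_cases hν : ν ∈ Icc (-N) N
    · have hc : ContractingWith (1 / 2) (Φ ν) := by
        refine ⟨by rw [← NNReal.coe_lt_coe]; norm_num,
          LipschitzWith.of_dist_le_mul fun w w' => ?_⟩
        simpa [dist_eq_norm] using hΦ ν hν w w'
      exact ⟨hc.fixedPoint, fun _ => hc.fixedPoint_isFixedPt⟩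
    · exact ⟨0, fun h => absurd h hν⟩
  choose W hW using hfix
  have hlip : ∀ ν ∈ Icc (-N) N, ∀ μ ∈ Icc (-N) N, ‖W ν - W μ‖ ≤ 2 * M * |ν - μ| := by
    intro ν hν μ hμ
    have h1 := hΦ ν hν (W ν) (W μ)
    have h2 : ‖Φ ν (W μ) - Φ μ (W μ)‖ ≤ M * |ν - μ| := by
      change ‖ν • (E' * volterra g φ (E * W μ)) - μ • (E' * volterra g φ (E * W μ))‖ ≤ _
      rw [← sub_smul, norm_smul, Real.norm_eq_abs, mul_comm]
      gcongr
      calc _ ≤ ‖E'‖ * ‖volterra g φ (E * W μ)‖ := norm_mul_le _ _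
        _ ≤ 1 * M := by
          gcongr
          exact norm_volterra_le hg hM _
        _ = M := one_mul M
    rw [hW ν hν] at h1
    rw [hW μ hμ] at h2
    have h3 := norm_sub_le_norm_sub_add_norm_sub (W ν) (Φ ν (W μ)) (W μ)
    linarith
  refine ⟨fun ν => E * W ν, ?_, fun ν hν => ?_⟩
  · have hWc : ContinuousOn W (Icc (-N) N) := by
      have hM0 : 0 ≤ 2 * M := mul_nonneg two_pos.le ((abs_nonneg _).trans (hM 0))
      refine (LipschitzOnWith.of_dist_le_mul (K := ⟨2 * M, hM0⟩) fun ν hν μ hμ => ?_).continuousOn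
      rw [dist_eq_norm, Real.dist_eq]
      exact hlip ν hν μ hμ
    exact continuousOn_const.mul hWc
  · change E * W ν = ν • volterra g φ (E * W ν)
    conv_lhs => rw [← hW ν hν]
    change E * (ν • (E' * volterra g φ (E * W ν))) = _
    rw [mul_smul_comm, ← mul_assoc, hEE', one_mul]

/-! ### Solutions of prescribed norm -/

/-- The exponential with its argument truncated to `[-R, R]`. -/
noncomputable def clampExp (R : ℝ) : C(ℝ, ℝ) :=
  ⟨fun x => Real.exp (max (-R) (min x R)), by fun_prop⟩

theorem clampExp_of_abs_le {R x : ℝ} (hx : |x| ≤ R) : clampExp R x = Real.exp x := by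
  obtain ⟨h1, h2⟩ := abs_le.1 hx
  change Real.exp (max (-R) (min x R)) = _
  rw [min_eq_left h2, max_eq_right h1]

theorem exp_neg_le_clampExp (R x : ℝ) : Real.exp (-R) ≤ clampExp R x :=
  Real.exp_le_exp.2 (le_max_left _ _)

theorem abs_clampExp_le {R : ℝ} (hR : 0 ≤ R) (x : ℝ) : |clampExp R x| ≤ Real.exp R := by
  change |Real.exp (max (-R) (min x R))| ≤ _
  rw [Real.abs_exp]
  exact Real.exp_le_exp.2 (max_le (by linarith) (min_le_right _ _))

theorem abs_exp_sub_exp_le {a b R : ℝ} (ha : a ≤ R) (hb : b ≤ R) :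
    |Real.exp a - Real.exp b| ≤ Real.exp R * |a - b| := by
  wlog h : b ≤ a generalizing a b
  · rw [abs_sub_comm, abs_sub_comm a]
    exact this hb ha (le_of_not_ge h)
  rw [abs_of_nonneg (sub_nonneg.2 (Real.exp_le_exp.2 h)), abs_of_nonneg (sub_nonneg.2 h)]
  calc Real.exp a - Real.exp b = Real.exp a * (1 - Real.exp (b - a)) := by
        rw [mul_sub, ← Real.exp_add]; ring_nf
    _ ≤ Real.exp R * (a - b) := by
        have := Real.add_one_le_exp (b - a)
        exact mul_le_mul (Real.exp_le_exp.2 ha) (by linarith)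
          (sub_nonneg.2 (Real.exp_le_one_iff.2 (by linarith))) (Real.exp_pos R).le

theorem abs_clampExp_sub_le {R : ℝ} (hR : 0 ≤ R) (x y : ℝ) :
    |clampExp R x - clampExp R y| ≤ Real.exp R * |x - y| := by
  have hle : ∀ z, max (-R) (min z R) ≤ R := fun z => max_le (by linarith) (min_le_right _ _)
  refine (abs_exp_sub_exp_le (hle x) (hle y)).trans
    (mul_le_mul_of_nonneg_left ?_ (Real.exp_pos R).le)
  have h1 := abs_max_sub_max_le_max (-R) (min x R) (-R) (min y R)
  have h2 := abs_min_sub_min_le_max x R y R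
  rw [sub_self, abs_zero, max_eq_right (abs_nonneg (min x R - min y R))] at h1
  rw [sub_self, abs_zero, max_eq_left (abs_nonneg (x - y))] at h2
  exact h1.trans h2

/-- The weight `sin (3πt/2)`. -/
noncomputable def sineWeight : C(ℝ, ℝ) :=
  ⟨fun t => Real.sin (3 / 2 * π * t), by fun_prop⟩

theorem abs_sineWeight_le (t : ℝ) : |sineWeight t| ≤ 1 :=
  Real.abs_sin_le_one _

theorem integral_neg_sineWeight_pos :
    0 < ∫ s in (2 / 3 : ℝ)..1, (s - 2 / 3) * -sineWeight s := by
  refine intervalIntegral.intervalIntegral_pos_of_pos_on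
    (Continuous.intervalIntegrable (by fun_prop) _ _) (fun s hs => ?_) (by norm_num)
  exact mul_pos (sub_pos.2 hs.1) (neg_pos.2 (sin_neg_of_two_thirds_lt ⟨hs.1, hs.2.le⟩))

theorem volterra_one (g φ : C(ℝ, ℝ)) (v : C(Icc (0 : ℝ) 1, ℝ)) : volterra g φ v 1 = 0 := by
  rw [volterra_apply]
  simp

/-- The normalisation `v - v(0)` of a solution of the terminal value problem, which satisfies the
boundary condition at `0`. -/
noncomputable def subLeft (v : C(Icc (0 : ℝ) 1, ℝ)) : C(Icc (0 : ℝ) 1, ℝ) :=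
  v - ContinuousMap.const _ (v 0)

theorem extLine_subLeft (v : C(Icc (0 : ℝ) 1, ℝ)) (t : ℝ) :
    extLine (subLeft v) t = extLine v t - v 0 := rfl

theorem abs_sub_le_two_mul_norm_subLeft (v : C(Icc (0 : ℝ) 1, ℝ)) (s t : Icc (0 : ℝ) 1) :
    |v s - v t| ≤ 2 * ‖subLeft v‖ := by
  have h : v s - v t = subLeft v s - subLeft v t := (sub_sub_sub_cancel_right _ _ _).symm
  have h1 := (subLeft v).norm_coe_le_norm s
  have h2 := (subLeft v).norm_coe_le_norm t
  have h3 := norm_sub_le (subLeft v s) (subLeft v t)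
  rw [h, ← Real.norm_eq_abs]
  linarith

/-- Since the weight has constant sign on `[2/3, 1]`, the oscillation of a solution of the terminal
value problem over that interval is at least a fixed multiple of `|ν|`. -/
theorem mul_abs_le_norm_subLeft {R ν : ℝ} {v : C(Icc (0 : ℝ) 1, ℝ)}
    (hv : v = ν • volterra sineWeight (clampExp R) v) :
    |ν| * (Real.exp (-R) * ∫ s in (2 / 3 : ℝ)..1, (s - 2 / 3) * -sineWeight s)
      ≤ 2 * ‖subLeft v‖ := by
  let p : Icc (0 : ℝ) 1 := ⟨2 / 3, by norm_num, by norm_num⟩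
  have hcv := continuous_extLine v
  have hp : v p = ν * ∫ s in (2 / 3 : ℝ)..1,
      (s - 2 / 3) * -sineWeight s * clampExp R (extLine v s) := by
    conv_lhs => rw [hv]
    change ν * volterra sineWeight (clampExp R) v p = _
    rw [volterra_apply, ← intervalIntegral.integral_neg]
    congr 2
    ext s
    ring
  have h1 : v 1 = 0 := by
    rw [hv]
    change ν * volterra sineWeight (clampExp R) v 1 = 0
    rw [volterra_one, mul_zero]
  have hJ : Real.exp (-R) * (∫ s in (2 / 3 : ℝ)..1, (s - 2 / 3) * -sineWeight s) ≤
      ∫ s in (2 / 3 : ℝ)..1, (s - 2 / 3) * -sineWeight s * clampExp R (extLine v s) := by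
    rw [← intervalIntegral.integral_const_mul]
    refine intervalIntegral.integral_mono_on (by norm_num)
      (Continuous.intervalIntegrable (by fun_prop) _ _)
      (Continuous.intervalIntegrable (by fun_prop) _ _) fun s hs => ?_
    rw [mul_comm]
    exact mul_le_mul_of_nonneg_left (exp_neg_le_clampExp _ _)
      (mul_nonneg (sub_nonneg.2 hs.1) (neg_nonneg.2 (sin_nonpos_of_two_thirds_le hs)))
  have hosc := abs_sub_le_two_mul_norm_subLeft v p 1
  rw [h1, sub_zero, hp, abs_mul] at hosc
  refine le_trans ?_ hosc
  gcongr
  exact hJ.trans (le_abs_self _)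

/-- The nonlocal term is unchanged when a constant is added to `u`, and the truncation is inactive
as soon as `2‖v - v(0)‖ ≤ R`; hence `v - v(0)` solves the nonlocal problem. -/
theorem solvesMixedIntegralEq_subLeft {R ν : ℝ} {v : C(Icc (0 : ℝ) 1, ℝ)}
    (hv : v = ν • volterra sineWeight (clampExp R) v) (hR : 2 * ‖subLeft v‖ ≤ R) :
    SolvesMixedIntegralEq (ν * ∫ x in (0 : ℝ)..1, Real.exp (extLine v x)) (subLeft v) := by
  have hval : ∀ t, v t = ν * volterra sineWeight (clampExp R) v t := fun t => by
    conv_lhs => rw [hv]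
    rfl
  have h1 : v 1 = 0 := by rw [hval, volterra_one, mul_zero]
  -- `v(1) = 0`, so `|v|` is bounded by the oscillation of `v`
  have hφ : ∀ s, clampExp R (extLine v s) = Real.exp (extLine v s) := by
    intro s
    refine clampExp_of_abs_le (le_trans ?_ hR)
    have := abs_sub_le_two_mul_norm_subLeft v (projIcc 0 1 zero_le_one s) 1
    rwa [h1, sub_zero] at this
  have hI := integral_exp_pos v
  have hterm : (fun s => (ν * ∫ x in (0 : ℝ)..1, Real.exp (extLine v x))
      * nonlocalTerm (subLeft v) s)
      = fun s => ν * (sineWeight s * clampExp R (extLine v s)) := by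
    ext s
    simp only [nonlocalTerm, extLine_subLeft, hφ, Real.exp_sub, intervalIntegral.integral_div]
    change _ = ν * (Real.sin (3 / 2 * π * s) * _)
    have := (Real.exp_pos (v 0)).ne'
    have := hI.ne'
    field_simp
  rw [solvesMixedIntegralEq_iff]
  intro t ht
  rw [← greenPotential_const_mul, hterm, greenPotential_const_mul, extLine_subLeft,
    extLine_apply v ht, hval, hval 0]
  change ν * (greenPotential _ t - _) - ν * (greenPotential _ 0 - _) = _
  rw [greenPotential_zero]
  ring

/-- Solutions of every norm `ρ > 0` exist for parameters of both signs: the norm of the normalised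
solution depends continuously on `ν`, vanishes at `ν = 0` and is at least `ρ` at `ν = ± N`. -/
theorem exists_solution_of_norm {ρ : ℝ} (hρ : 0 < ρ) :
    (∃ (lam : ℝ) (u : C(Icc (0 : ℝ) 1, ℝ)), 0 < lam ∧ ‖u‖ = ρ ∧ SolvesMixedIntegralEq lam u) ∧
    (∃ (lam : ℝ) (u : C(Icc (0 : ℝ) 1, ℝ)), lam < 0 ∧ ‖u‖ = ρ ∧ SolvesMixedIntegralEq lam u) := by
  have hR : 0 ≤ 2 * ρ := by positivity
  set c : ℝ := Real.exp (-(2 * ρ)) * ∫ s in (2 / 3 : ℝ)..1, (s - 2 / 3) * -sineWeight s with hc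
  have hc0 : 0 < c := mul_pos (Real.exp_pos _) integral_neg_sineWeight_pos
  -- `N` is the value of `|ν|` at which the linear lower bound for the norm reaches `ρ`
  obtain ⟨N, hN, hNc⟩ : ∃ N : ℝ, 0 < N ∧ N * c = 2 * ρ :=
    ⟨2 * ρ / c, by positivity, div_mul_cancel₀ _ hc0.ne'⟩
  obtain ⟨V, hVc, hV⟩ := exists_continuousOn_volterra_solution abs_sineWeight_le
    (Real.exp_pos _).le (abs_clampExp_sub_le hR) (abs_clampExp_le hR) hN.le
  have hn : ContinuousOn (fun ν => ‖subLeft (V ν)‖) (Icc (-N) N) := by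
    have : Continuous subLeft := by
      unfold subLeft
      exact continuous_id.sub (ContinuousMap.continuous_const'.comp
        (continuous_eval_const 0))
    exact (this.comp_continuousOn hVc).norm
  have h0 : ‖subLeft (V 0)‖ = 0 := by
    have : V 0 = 0 := by
      rw [hV 0 ⟨by linarith, hN.le⟩, zero_smul]
    rw [this, norm_eq_zero]
    ext t
    exact sub_self _
  have hlarge : ∀ ν ∈ Icc (-N) N, |ν| = N → ρ ≤ ‖subLeft (V ν)‖ := by
    intro ν hν habs
    have := mul_abs_le_norm_subLeft (hV ν hν)
    rw [habs, ← hc, hNc] at this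
    linarith
  have hsol : ∀ ν ∈ Icc (-N) N, ‖subLeft (V ν)‖ = ρ →
      SolvesMixedIntegralEq (ν * ∫ x in (0 : ℝ)..1, Real.exp (extLine (V ν) x))
        (subLeft (V ν)) := fun ν hν hnorm =>
    solvesMixedIntegralEq_subLeft (hV ν hν) (by rw [hnorm])
  have hne : ∀ ν, ‖subLeft (V ν)‖ = ρ → ν ≠ 0 := by
    rintro ν hnorm rfl
    exact hρ.ne (h0.symm.trans hnorm)
  constructor
  · obtain ⟨ν, hν, hnorm⟩ := intermediate_value_Icc hN.le
      (hn.mono (Icc_subset_Icc_left (by linarith)))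
      ⟨h0.le.trans hρ.le, hlarge N ⟨by linarith, le_rfl⟩ (abs_of_pos hN)⟩
    exact ⟨_, _, mul_pos (hν.1.lt_of_ne' (hne ν hnorm)) (integral_exp_pos _), hnorm,
      hsol ν ⟨by linarith [hν.1], hν.2⟩ hnorm⟩
  · obtain ⟨ν, hν, hnorm⟩ := intermediate_value_Icc' (neg_nonpos.2 hN.le)
      (hn.mono (Icc_subset_Icc_right hN.le))
      ⟨h0.le.trans hρ.le, hlarge (-N) ⟨le_rfl, by linarith⟩ (by rw [abs_neg, abs_of_pos hN])⟩
    exact ⟨_, _, mul_neg_of_neg_of_pos (hν.2.lt_of_ne (hne ν hnorm)) (integral_exp_pos _), hnorm,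
      hsol ν ⟨hν.1, by linarith [hν.2]⟩ hnorm⟩

/-! ### The nonlocal problem -/

theorem mainTheorem2 :
    -- the boundary value problem and the integral equation have the same solutions
    (∀ (lam : ℝ) (u : C(Icc (0 : ℝ) 1, ℝ)),
      SolvesMixedBVP lam u ↔ SolvesMixedIntegralEq lam u) ∧
    -- explicit form of the lower function
    (∀ ρ : ℝ, 0 < ρ →
      (∀ t ∈ Icc (0 : ℝ) (2 / 3),
        lowerF ρ t =
          Real.exp (-2 * ρ) *
              (4 / (9 * π ^ 2) * Real.sin (3 / 2 * π * t) + 2 * t / (3 * π))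
            + Real.exp (2 * ρ) * (-(2 * t / (3 * π)))) ∧
      (∀ t ∈ Icc (2 / 3 : ℝ) 1,
        lowerF ρ t =
          Real.exp (-2 * ρ) * (4 / (9 * π))
            + Real.exp (2 * ρ) *
              (4 / (9 * π ^ 2) * Real.sin (3 / 2 * π * t) - 4 / (9 * π)))) ∧
    -- large radii: the lower function is nowhere positive
    (∀ ρ : ℝ, Real.log ((2 : ℝ) ^ (1 / 4 : ℝ)) ≤ ρ →
      lowerF ρ 0 = 0 ∧ ∀ t ∈ Icc (0 : ℝ) 1, lowerF ρ t ≤ 0) ∧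
    -- small radii
    (∀ ρ : ℝ, 0 < ρ → ρ < Real.log ((2 : ℝ) ^ (1 / 4 : ℝ)) →
      (maxPoint ρ ∈ Ioo (0 : ℝ) (2 / 3) ∧ 0 < lowerF ρ (maxPoint ρ) ∧
        ∀ t ∈ Icc (0 : ℝ) 1, t ≠ maxPoint ρ → lowerF ρ t < lowerF ρ (maxPoint ρ)) ∧
      (∃ (lam : ℝ) (u : C(Icc (0 : ℝ) 1, ℝ)), 0 < lam ∧ ‖u‖ = ρ ∧
        SolvesMixedBVP lam u ∧ SolvesMixedIntegralEq lam u) ∧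
      (∃ (lam : ℝ) (u : C(Icc (0 : ℝ) 1, ℝ)), lam < 0 ∧ ‖u‖ = ρ ∧
        SolvesMixedBVP lam u ∧ SolvesMixedIntegralEq lam u) ∧
      (∀ (lam : ℝ) (u : C(Icc (0 : ℝ) 1, ℝ)), ‖u‖ = ρ →
        (SolvesMixedBVP lam u ∨ SolvesMixedIntegralEq lam u) →
        |lam| ≤ ρ / lowerF ρ (maxPoint ρ))) := by
  refine ⟨solvesMixedBVP_iff_solvesMixedIntegralEq,
    fun ρ _ => ⟨fun t ht => lowerF_of_le ht, fun t ht => lowerF_of_ge ht⟩,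
    fun ρ hρ => ⟨lowerF_zero ρ, fun t ht => lowerF_nonpos hρ ht⟩, fun ρ h0 h1 => ?_⟩
  obtain ⟨hmem, hpos, hmax⟩ := maxPoint_isStrictMax h0 h1
  obtain ⟨⟨l, u, hl, hu, hs⟩, l', u', hl', hu', hs'⟩ := exists_solution_of_norm h0
  refine ⟨⟨hmem, hpos, hmax⟩,
    ⟨l, u, hl, hu, (solvesMixedBVP_iff_solvesMixedIntegralEq l u).2 hs, hs⟩,
    ⟨l', u', hl', hu', (solvesMixedBVP_iff_solvesMixedIntegralEq l' u').2 hs', hs'⟩, ?_⟩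
  rintro lam w rfl hw
  rw [solvesMixedBVP_iff_solvesMixedIntegralEq, or_self] at hw
  exact abs_le_div_lowerF hw ⟨hmem.1.le, by linarith [hmem.2]⟩ hpos
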